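/- **Definition.** A sequence of real numbers $\lambda(k)$, $k\in\mathbb{Z}$, that is strictly increasing, $\dots<\lambda(-1)<\lambda(0)<\lambda(1)<\dots$, and has only finitely many terms in each bounded interval $(-x,x)$, is called a *Menshov spectrum for $\mathbb{R}$* if for every Lebesgue measurable function $f:\mathbb{R}\to\mathbb{C}$ there are complex coefficients $c(k)$, $k\in\mathbb{Z}$, such that $$f(t)=\lim_{x\to\infty}\ \sum_{k\,:\,|\lambda(k)|<x} c(k)\,e^{i\lambda(k)t}\qquad\text{for almost every } t\in\mathbb{R}.$$ **Theorem.** Let $r(n)$, $n\in\mathbb{Z}$, be independent random variables, each uniformly distributed on the segment $[-\tfrac12,\tfrac12]$. Then almost surely the sequence $\lambda(n)=n+r(n)$, $n\in\mathbb{Z}$, is a Menshov spectrum for $\mathbb{R}$. -/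

import Mathlib

open MeasureTheory ProbabilityTheory Filter Topology

/-- A sequence of real frequencies `⋯ < lam (-1) < lam 0 < lam 1 < ⋯`, with only finitely many
terms in every bounded interval `(-x, x)`, is a Menshov spectrum for `ℝ` if every
(Lebesgue) measurable function `f` on `ℝ` equals, almost everywhere, the sum of a series
`∑ c k * exp (i * lam k * t)`, understood as the limit of the symmetric partial sums
`∑_{|lam k| < x}` as the real number `x` tends to infinity. -/
structure IsMenshovSpectrum (lam : ℤ → ℝ) : Prop where
  strictMono : StrictMono lam
  finite_abs_lt : ∀ x : ℝ, {k : ℤ | |lam k| < x}.Finite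
  exists_representation : ∀ f : ℝ → ℂ, AEMeasurable f volume →
    ∃ c : ℤ → ℂ, ∀ᵐ t : ℝ ∂volume,
      Tendsto
        (fun x : ℝ => ∑ k ∈ (finite_abs_lt x).toFinset,
          c k * Complex.exp (Complex.I * (lam k : ℂ) * (t : ℂ)))
        atTop (𝓝 (f t))

/-! Almost surely the spectrum is rich in patterns: for every finite set `{l + s l}` with `|s l| ≤
1/2`, its translates by `±N, …, ±KN` occur in it, approximately and simultaneously, for arbitrarily
large `N` (`ae_hasPatterns`). Along a lacunary sequence of `N` these are independent events with
probabilities bounded below, so the second Borel–Cantelli lemma applies.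

The rest is deterministic. Off a small subset of `[-T, T]`, a measurable `g` is close to a sum `G`
with one frequency near each integer of a finite range (`exists_sepSum_near_in_measure`). There are
also cosine sums `p` without constant term, with coefficients as small as desired, such that `p(Nt)`
is close to 1 and has bounded partial sums off a small set (`exists_kernel`). The frequencies of
`p(Nt) G(t)` form translated patterns, so moving them slightly onto the spectrum gives a block of
high frequencies approximating `g` (`exists_block`). A cutoff `|lam| < x` splits at most one
translated group, which is negligible because the coefficients of `p` are small against those of
`G`; the rest is a partial sum of `p(Nt)` times `G`, dominated by `B |g|` up to a small error.

Each block is built to approximate the residual left by the previous ones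
(`exists_representation_of_hasPatterns`). Since `B` depends only on `T` and `ε`, the residual can be
made small against the next `B`, so that the next block has small partial sums throughout. The
exceptional sets have summable measures, which gives convergence almost everywhere. -/

/-! ### Cosine sums and Fejér-type kernels -/

/-- The cosine sum `∑_{1 ≤ k ≤ m} b k (e^{iku} + e^{-iku})`. -/
noncomputable def cosSum (b : ℕ → ℝ) (m : ℕ) (u : ℝ) : ℝ :=
  ∑ k ∈ Finset.Icc 1 m, b k * (2 * Real.cos (k * u))

theorem cosSum_zero (b : ℕ → ℝ) (u : ℝ) : cosSum b 0 u = 0 := by simp [cosSum]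

theorem cosSum_succ (b : ℕ → ℝ) (m : ℕ) (u : ℝ) :
    cosSum b (m + 1) u = cosSum b m u + b (m + 1) * (2 * Real.cos ((m + 1 : ℕ) * u)) := by
  simp [cosSum, Finset.sum_Icc_succ_top]

theorem cosSum_eq_of_le {b : ℕ → ℝ} {K m : ℕ} (hb : ∀ k, K < k → b k = 0) (hm : K ≤ m) (u : ℝ) :
    cosSum b m u = cosSum b K u := by
  induction m, hm using Nat.le_induction with
  | base => rfl
  | succ m hm ih => rw [cosSum_succ, ih, hb _ (by omega)]; simp

/-- The Dirichlet kernel. -/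
noncomputable def dirichlet (m : ℕ) (u : ℝ) : ℝ := 1 + cosSum (fun _ => 1) m u

theorem dirichlet_succ (m : ℕ) (u : ℝ) :
    dirichlet (m + 1) u = dirichlet m u + 2 * Real.cos ((m + 1 : ℕ) * u) := by
  simp [dirichlet, cosSum_succ]; ring

theorem sin_mul_dirichlet (m : ℕ) (u : ℝ) :
    Real.sin (u / 2) * dirichlet m u = Real.sin ((m + 1 / 2) * u) := by
  induction m with
  | zero => simp [dirichlet, cosSum_zero]; congr 1; ring
  | succ m ih =>
    rw [dirichlet_succ, mul_add, ih]
    have h1 : (m + 1 / 2 : ℝ) * u = ((m + 1 : ℕ) : ℝ) * u - u / 2 := by push_cast; ring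
    have h2 : (((m + 1 : ℕ) : ℝ) + 1 / 2 : ℝ) * u = ((m + 1 : ℕ) : ℝ) * u + u / 2 := by ring
    rw [h1, h2, Real.sin_sub, Real.sin_add]; ring

theorem abs_dirichlet_le {θ u : ℝ} (hθ : 0 < θ) (hu : θ ≤ |Real.sin (u / 2)|) (m : ℕ) :
    |dirichlet m u| ≤ 1 / θ := by
  rw [le_div_iff₀ hθ]
  calc |dirichlet m u| * θ ≤ |dirichlet m u| * |Real.sin (u / 2)| := by gcongr
    _ = |Real.sin ((m + 1 / 2) * u)| := by rw [← abs_mul, mul_comm, sin_mul_dirichlet]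
    _ ≤ 1 := Real.abs_sin_le_one _

/-- The sum telescopes: `sin (u/2) * sin ((l + 1/2) u)` is half of `cos (l u) - cos ((l + 1) u)`. -/
theorem sin_sq_mul_sum_dirichlet (Q : ℕ) (u : ℝ) :
    Real.sin (u / 2) ^ 2 * ∑ l ∈ Finset.range Q, dirichlet l u = (1 - Real.cos (Q * u)) / 2 := by
  induction Q with
  | zero => simp
  | succ Q ih =>
    rw [Finset.sum_range_succ, mul_add, ih, pow_two, mul_assoc, sin_mul_dirichlet]
    have h1 : (Q : ℝ) * u = (Q + 1 / 2) * u - u / 2 := by ring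
    have h2 : ((Q + 1 : ℕ) : ℝ) * u = (Q + 1 / 2) * u + u / 2 := by push_cast; ring
    rw [h2, h1, Real.cos_sub, Real.cos_add]; ring

theorem abs_sum_dirichlet_le {θ u : ℝ} (hθ : 0 < θ) (hu : θ ≤ |Real.sin (u / 2)|) (Q : ℕ) :
    |∑ l ∈ Finset.range Q, dirichlet l u| ≤ 1 / θ ^ 2 := by
  rw [le_div_iff₀ (by positivity)]
  calc |∑ l ∈ Finset.range Q, dirichlet l u| * θ ^ 2
      ≤ |∑ l ∈ Finset.range Q, dirichlet l u| * |Real.sin (u / 2)| ^ 2 := by gcongr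
    _ = |(1 - Real.cos (Q * u)) / 2| := by
        rw [← sin_sq_mul_sum_dirichlet, abs_mul, abs_pow, mul_comm]
    _ ≤ 1 := by
        rw [abs_le]; constructor <;> linarith [Real.neg_one_le_cos (Q * u), Real.cos_le_one (Q * u)]

/-- The coefficients of `1 - F`, where `F` is the Fejér kernel of order `Q`. -/
noncomputable def fejerCoeff (Q : ℕ) (k : ℕ) : ℝ := if 1 ≤ k ∧ k ≤ Q then -(1 - k / Q) else 0

theorem abs_fejerCoeff_le (Q k : ℕ) : |fejerCoeff Q k| ≤ 1 := by
  unfold fejerCoeff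
  split_ifs with h
  · have : (k : ℝ) / Q ≤ 1 := div_le_one_of_le₀ (by exact_mod_cast h.2) (by positivity)
    have : (0 : ℝ) ≤ (k : ℝ) / Q := by positivity
    rw [abs_le]; constructor <;> linarith
  · simp

/-- Abel summation. At `m = Q` the last term drops out, leaving the Fejér kernel; for `m ≤ Q` the
right side is a convex combination of Dirichlet kernels, which bounds partial sums independently of
`Q`. -/
theorem one_sub_cosSum_fejerCoeff {Q : ℕ} (hQ : 0 < Q) (u : ℝ) (m : ℕ) (hm : m ≤ Q) :
    1 - cosSum (fejerCoeff Q) m u =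
      1 / Q * ∑ l ∈ Finset.range m, dirichlet l u + (1 - m / Q) * dirichlet m u := by
  induction m with
  | zero => simp [cosSum_zero, dirichlet]
  | succ m ih =>
    have hQ' : (Q : ℝ) ≠ 0 := by positivity
    have h := ih (by omega)
    rw [cosSum_succ, Finset.sum_range_succ, dirichlet_succ]
    have hc : fejerCoeff Q (m + 1) = -(1 - ((m + 1 : ℕ) : ℝ) / Q) := if_pos ⟨by omega, hm⟩
    rw [hc]
    have : cosSum (fejerCoeff Q) m u = 1 - (1 / Q * ∑ l ∈ Finset.range m, dirichlet l u
      + (1 - m / Q) * dirichlet m u) := by linarith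
    rw [this]; push_cast; field_simp; ring

theorem abs_cosSum_fejerCoeff_le {Q : ℕ} (hQ : 0 < Q) {θ u : ℝ} (hθ : 0 < θ)
    (hu : θ ≤ |Real.sin (u / 2)|) (m : ℕ) :
    |cosSum (fejerCoeff Q) m u| ≤ 1 + 1 / θ := by
  wlog hm : m ≤ Q generalizing m
  · rw [cosSum_eq_of_le (b := fejerCoeff Q) (K := Q) (fun k hk => if_neg (by omega)) (by omega)]
    exact this Q le_rfl
  have hQ' : (0 : ℝ) < Q := by positivity
  have h1 : |∑ l ∈ Finset.range m, dirichlet l u| ≤ m * (1 / θ) := by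
    refine (Finset.abs_sum_le_sum_abs _ _).trans ?_
    refine (Finset.sum_le_card_nsmul _ _ _ fun l _ => abs_dirichlet_le hθ hu l).trans ?_
    simp
  have hm' : (m : ℝ) / Q ≤ 1 := div_le_one_of_le₀ (by exact_mod_cast hm) (by positivity)
  have h2 : |1 - cosSum (fejerCoeff Q) m u| ≤ 1 / θ := by
    rw [one_sub_cosSum_fejerCoeff hQ u m hm]
    refine (abs_add_le _ _).trans ?_
    rw [abs_mul, abs_mul, abs_of_nonneg (by positivity : (0 : ℝ) ≤ 1 / Q),
      abs_of_nonneg (by linarith : (0 : ℝ) ≤ 1 - m / Q)]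
    calc _ ≤ 1 / Q * (m * (1 / θ)) + (1 - m / Q) * (1 / θ) := by
          have h3 := abs_dirichlet_le hθ hu m
          have h4 : (0 : ℝ) ≤ 1 - m / Q := by linarith
          gcongr
      _ = 1 / θ := by field_simp; ring
  rw [abs_le] at h2 ⊢; constructor <;> linarith [h2.1, h2.2]

theorem abs_cosSum_fejerCoeff_sub_one_le {Q : ℕ} (hQ : 0 < Q) {θ u : ℝ} (hθ : 0 < θ)
    (hu : θ ≤ |Real.sin (u / 2)|) :
    |cosSum (fejerCoeff Q) Q u - 1| ≤ 1 / (Q * θ ^ 2) := by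
  have hQ' : (0 : ℝ) < Q := by positivity
  rw [abs_sub_comm, one_sub_cosSum_fejerCoeff hQ u Q le_rfl, div_self hQ'.ne', sub_self, zero_mul,
    add_zero, abs_mul, abs_of_nonneg (by positivity : (0 : ℝ) ≤ 1 / Q)]
  calc _ ≤ 1 / (Q : ℝ) * (1 / θ ^ 2) := by gcongr; exact abs_sum_dirichlet_le hθ hu Q
    _ = _ := by rw [div_mul_div_comm, one_mul]

theorem cosSum_add (b c : ℕ → ℝ) (m : ℕ) (u : ℝ) :
    cosSum (fun k => b k + c k) m u = cosSum b m u + cosSum c m u := by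
  simp [cosSum, add_mul, Finset.sum_add_distrib]

theorem cosSum_const_mul (v : ℝ) (b : ℕ → ℝ) (m : ℕ) (u : ℝ) :
    cosSum (fun k => v * b k) m u = v * cosSum b m u := by
  simp [cosSum, Finset.mul_sum, mul_assoc]

theorem cosSum_dilate {q : ℕ} (hq : 0 < q) (b : ℕ → ℝ) (m : ℕ) (u : ℝ) :
    cosSum (fun k => if q ∣ k then b (k / q) else 0) m u = cosSum b (m / q) (q * u) := by
  induction m with
  | zero => simp [cosSum_zero]
  | succ m ih =>
    rw [cosSum_succ, ih, Nat.succ_div]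
    split_ifs with h
    · rw [cosSum_succ]
      obtain ⟨j, hj⟩ := h
      have : m / q + 1 = j := by
        rw [← Nat.succ_div_of_dvd ⟨j, hj⟩, hj, Nat.mul_div_cancel_left _ hq]
      rw [this, hj]
      push_cast; congr 4; ring
    · simp

/-- A sum of `J` lacunary dilates of `1 - F`, with weights `v`: the coefficients are at most `v`,
while the values and the partial sums are controlled off a union of `J` small sets. -/
theorem exists_lacunary_kernel {θ δ v : ℝ} (hθ : 0 < θ) (hδ : 0 < δ) (hv : 0 ≤ v) (J : ℕ) :
    ∃ (K : ℕ) (b : ℕ → ℝ) (A : Finset ℕ), A.card ≤ J ∧ (∀ q ∈ A, 1 ≤ q) ∧ (∀ k, |b k| ≤ v) ∧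
      (∀ k, K < k → b k = 0) ∧ ∀ u : ℝ, (∀ q ∈ A, θ ≤ |Real.sin (q * u / 2)|) →
        |cosSum b K u - J * v| ≤ J * v * δ ∧
        ∀ m, |cosSum b m u| ≤ J * v * (1 + δ) + v * (1 + 1 / θ) := by
  induction J with
  | zero => exact ⟨0, 0, ∅, by simp, by simp, by simpa, by simp, fun u _ =>
      ⟨by simp [cosSum_zero], fun m => by simp [cosSum]; positivity⟩⟩
  | succ J ih =>
    obtain ⟨K, b, A, hA, hA1, hbv, hbK, hb⟩ := ih
    obtain ⟨Q, hQ⟩ := exists_nat_gt (1 / (δ * θ ^ 2))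
    have hQ0 : (0 : ℝ) < Q := lt_trans (by positivity) hQ
    have hQ0' : 0 < Q := by exact_mod_cast hQ0
    have hQ1 : 1 / (Q * θ ^ 2) ≤ δ := by
      rw [div_le_iff₀ (by positivity)]
      rw [div_lt_iff₀ (by positivity)] at hQ
      nlinarith
    -- Dilating by `K + 1` puts the new frequencies beyond all old ones, so coefficients never add
    -- up and a truncation meets at most one unfinished dilate.
    set c : ℕ → ℝ := fun k => v * (if (K + 1) ∣ k then fejerCoeff Q (k / (K + 1)) else 0) with hc
    have hcK : ∀ k, k ≤ K → c k = 0 := fun k h => by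
      simp [hc, Nat.div_eq_of_lt (Nat.lt_succ_of_le h), fejerCoeff]
    have hcs : ∀ m u, cosSum c m u = v * cosSum (fejerCoeff Q) (m / (K + 1)) ((K + 1 : ℕ) * u) :=
      fun m u => by rw [hc, cosSum_const_mul, cosSum_dilate (Nat.succ_pos K)]
    have hcv : ∀ k, |c k| ≤ v := fun k => by
      rw [hc]; simp only [abs_mul, abs_of_nonneg hv]
      split_ifs
      · exact mul_le_of_le_one_right hv (abs_fejerCoeff_le _ _)
      · simpa using hv
    refine ⟨(K + 1) * Q + K, fun k => b k + c k, insert (K + 1) A, ?_, ?_, ?_, ?_, ?_⟩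
    · exact (Finset.card_insert_le _ _).trans (by omega)
    · intro q hq
      rcases Finset.mem_insert.1 hq with rfl | hq
      · omega
      · exact hA1 q hq
    · intro k
      rcases lt_or_ge K k with h | h
      · simpa [hbK k h] using hcv k
      · simpa [hcK k h] using hbv k
    · intro k hk
      have h1 : b k = 0 := hbK k (by nlinarith)
      have h2 : fejerCoeff Q (k / (K + 1)) = 0 ∨ ¬ (K + 1) ∣ k := by
        by_cases h : (K + 1) ∣ k
        · left
          obtain ⟨j, rfl⟩ := h
          rw [Nat.mul_div_cancel_left _ (Nat.succ_pos K)]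
          refine if_neg ?_
          intro hj
          nlinarith
        · exact Or.inr h
      rcases h2 with h2 | h2 <;> simp [h1, hc, h2]
    · intro u hu
      have hu1 : θ ≤ |Real.sin (((K + 1 : ℕ) : ℝ) * u / 2)| := hu _ (Finset.mem_insert_self _ _)
      obtain ⟨hb1, hb2⟩ := hb u fun q hq => hu q (Finset.mem_insert_of_mem hq)
      have h3 := abs_cosSum_fejerCoeff_sub_one_le hQ0' hθ hu1
      have h4 := abs_cosSum_fejerCoeff_le hQ0' hθ hu1
      constructor
      · have hdiv : ((K + 1) * Q + K) / (K + 1) = Q := by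
          rw [Nat.mul_add_div (Nat.succ_pos K), Nat.div_eq_of_lt (Nat.lt_succ_self K), add_zero]
        rw [cosSum_add, cosSum_eq_of_le hbK (by omega), hcs, hdiv]
        have h5 : |v * cosSum (fejerCoeff Q) Q ((K + 1 : ℕ) * u) - v| ≤ v * δ := by
          rw [← mul_sub_one, abs_mul, abs_of_nonneg hv]
          exact mul_le_mul_of_nonneg_left (h3.trans hQ1) hv
        rw [abs_le] at *
        push_cast at *
        constructor <;> nlinarith [h5.1, h5.2, hb1.1, hb1.2]
      · intro m
        rw [cosSum_add, hcs]
        rcases lt_or_ge m (K + 1) with hm | hm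
        · rw [Nat.div_eq_of_lt hm, cosSum_zero, mul_zero, add_zero]
          refine (hb2 m).trans ?_
          push_cast
          nlinarith [mul_nonneg hv hδ.le]
        · rw [cosSum_eq_of_le hbK (by omega)]
          have h5 : |v * cosSum (fejerCoeff Q) (m / (K + 1)) ((K + 1 : ℕ) * u)|
              ≤ v * (1 + 1 / θ) := by
            rw [abs_mul, abs_of_nonneg hv]
            exact mul_le_mul_of_nonneg_left (h4 _) hv
          have h6 : |cosSum b K u| ≤ J * v * (1 + δ) := by
            rw [abs_le] at *
            constructor <;> nlinarith [hb1.1, hb1.2, mul_nonneg (Nat.cast_nonneg (α := ℝ) J) hv]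
          refine (abs_add_le _ _).trans ?_
          have h7 : ((J + 1 : ℕ) : ℝ) * v * (1 + δ) = J * v * (1 + δ) + v * (1 + δ) := by
            push_cast; ring
          have h8 : 0 ≤ v * (1 + δ) := by positivity
          linarith

/-! ### Kernels with small coefficients on a bounded interval -/

theorem abs_sub_round_lt_of_abs_sin_lt {θ y : ℝ} (h : |Real.sin y| < θ) :
    |y - Real.pi * round (y / Real.pi)| < Real.pi * θ / 2 := by
  have hπ := Real.pi_pos
  set m := round (y / Real.pi) with hm
  have h1 : |y - Real.pi * m| ≤ Real.pi / 2 := by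
    have := abs_sub_round (y / Real.pi)
    have h2 : y - Real.pi * m = Real.pi * (y / Real.pi - m) := by field_simp
    rw [h2, abs_mul, abs_of_pos hπ]
    nlinarith
  have h2 := Real.mul_abs_le_abs_sin h1
  have h3 : |Real.sin (y - Real.pi * m)| = |Real.sin y| := by
    rw [mul_comm, Real.sin_sub_int_mul_pi, abs_mul]; simp
  rw [h3] at h2
  have h4 := h2.trans_lt h
  rw [div_mul_eq_mul_div, div_lt_iff₀ hπ] at h4
  linarith

/-- The zeros are `2π/L` apart, so about `L T` neighbourhoods of radius `πθ/L` suffice; `L` cancels,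
and every dilate costs the same measure. -/
theorem volume_abs_sin_lt_le {T θ L : ℝ} (hT : 0 ≤ T) (hθ : 0 ≤ θ) (hL : 1 ≤ L) :
    volume {t : ℝ | t ∈ Set.Icc (-T) T ∧ |Real.sin (L * t / 2)| < θ} ≤
      ENNReal.ofReal (2 * Real.pi * (2 * T + 3) * θ) := by
  have hπ := Real.pi_pos
  have hπ3 := Real.pi_gt_three
  set B : ℕ := ⌊L * T + 1⌋₊ with hB
  have hBle : (B : ℝ) ≤ L * T + 1 := Nat.floor_le (by positivity)
  have hsub : {t : ℝ | t ∈ Set.Icc (-T) T ∧ |Real.sin (L * t / 2)| < θ} ⊆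
      ⋃ m ∈ Finset.Icc (-(B : ℤ)) B, Metric.closedBall (2 * Real.pi * m / L) (Real.pi * θ / L) := by
    rintro t ⟨⟨ht1, ht2⟩, ht⟩
    have h := abs_sub_round_lt_of_abs_sin_lt ht
    set m := round (L * t / 2 / Real.pi) with hm
    have hm1 := abs_sub_round (L * t / 2 / Real.pi)
    rw [← hm] at hm1
    have hq : |L * t / 2 / Real.pi| ≤ L * T / 2 := by
      rw [abs_div, abs_div, abs_mul, abs_of_pos (by linarith : 0 < L), abs_of_pos hπ]
      rw [div_le_iff₀ hπ, abs_of_pos (by norm_num : (0:ℝ) < 2)]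
      have : |t| ≤ T := abs_le.2 ⟨ht1, ht2⟩
      have h0 : L * |t| ≤ L * T := by gcongr
      nlinarith [mul_nonneg (by linarith : 0 ≤ L) hT]
    have hmB : |(m : ℝ)| ≤ L * T + 1 := by
      rw [abs_le] at *
      have := mul_nonneg (by linarith : 0 ≤ L) hT
      constructor <;> linarith [hq.1, hq.2, hm1.1, hm1.2]
    have hmB' : m.natAbs ≤ B := Nat.le_floor (by rwa [Nat.cast_natAbs, Int.cast_abs])
    simp only [Set.mem_iUnion, Finset.mem_Icc, Metric.mem_closedBall, Real.dist_eq]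
    refine ⟨m, ⟨by omega, by omega⟩, ?_⟩
    have hL0 : 0 < L := by linarith
    have h2 : t - 2 * Real.pi * m / L = (L * t / 2 - Real.pi * m) * (2 / L) := by
      field_simp
    rw [h2, abs_mul, abs_of_pos (by positivity : 0 < 2 / L)]
    calc _ ≤ Real.pi * θ / 2 * (2 / L) := by gcongr
      _ = _ := by field_simp
  refine (measure_mono hsub).trans ((measure_biUnion_finset_le _ _).trans ?_)
  simp only [Real.volume_closedBall, Finset.sum_const, nsmul_eq_mul, Int.card_Icc]
  rw [← ENNReal.ofReal_natCast, ← ENNReal.ofReal_mul (by positivity)]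
  apply ENNReal.ofReal_le_ofReal
  have h1 : (((B : ℤ) + 1 - -(B : ℤ)).toNat : ℝ) ≤ L * (2 * T + 3) := by
    have : ((B : ℤ) + 1 - -(B : ℤ)).toNat = 2 * B + 1 := by omega
    rw [this]; push_cast; nlinarith
  calc _ ≤ L * (2 * T + 3) * (2 * (Real.pi * θ / L)) := by gcongr
    _ = _ := by field_simp

/-- Cosine sums with arbitrarily small coefficients which are close to `1`, and have uniformly
bounded partial sums, off a set of measure `ε`. -/
theorem exists_kernel {T ε : ℝ} (hT : 0 ≤ T) (hε : 0 < ε) :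
    ∃ B : ℝ, 0 ≤ B ∧ ∀ η : ℝ, 0 < η → ∃ (K : ℕ) (b : ℕ → ℝ), (∀ k, |b k| ≤ η) ∧
      ∀ N : ℕ, 1 ≤ N → ∃ E : Set ℝ, volume E ≤ ENNReal.ofReal ε ∧
        ∀ t ∈ Set.Icc (-T) T, t ∉ E →
          |cosSum b K (N * t) - 1| ≤ η ∧ ∀ m, |cosSum b m (N * t)| ≤ B := by
  have hπ := Real.pi_pos
  set C : ℝ := 2 * Real.pi * (2 * T + 3) with hC
  have hC0 : 0 < C := by positivity
  refine ⟨3 + C / ε, by positivity, fun η hη => ?_⟩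
  set δ : ℝ := min η 1 with hδ
  have hδ0 : 0 < δ := by positivity
  have hδη : δ ≤ η := min_le_left _ _
  have hδ1 : δ ≤ 1 := min_le_right _ _
  obtain ⟨M, hM⟩ := exists_nat_gt (1 / δ)
  have hM0 : (0 : ℝ) < M := lt_trans (by positivity) hM
  have hMδ : 1 / (M : ℝ) ≤ δ := by
    rw [div_lt_iff₀ hδ0] at hM
    rw [div_le_iff₀ hM0]; linarith
  -- Each of the `M` dilates excludes measure `C θ`, so this `θ` makes the total `ε`. The unfinished
  -- dilate contributes at most `(1/M)(1 + 1/θ) = 1/M + C/ε`, bounded in `M`; hence `B` can be fixed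
  -- before `η`.
  have hθ : 0 < ε / (C * M) := by positivity
  obtain ⟨K, b, A, hA, hA1, hbv, -, hb⟩ :=
    exists_lacunary_kernel (v := 1 / (M : ℝ)) hθ hδ0 (by positivity) M
  have hMv : (M : ℝ) * (1 / M) = 1 := by field_simp
  refine ⟨K, b, fun k => (hbv k).trans (hMδ.trans hδη), fun N hN => ?_⟩
  refine ⟨⋃ q ∈ A, {t : ℝ | t ∈ Set.Icc (-T) T ∧
    |Real.sin (((q * N : ℕ) : ℝ) * t / 2)| < ε / (C * M)}, ?_, fun t ht htE => ?_⟩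
  · refine (measure_biUnion_finset_le _ _).trans ?_
    have hle : ∀ q ∈ A, volume {t : ℝ | t ∈ Set.Icc (-T) T ∧
        |Real.sin (((q * N : ℕ) : ℝ) * t / 2)| < ε / (C * M)} ≤
        ENNReal.ofReal (C * (ε / (C * M))) := fun q hq =>
      volume_abs_sin_lt_le hT hθ.le (by exact_mod_cast Nat.mul_pos (hA1 q hq) hN)
    refine (Finset.sum_le_card_nsmul _ _ _ hle).trans ?_
    rw [nsmul_eq_mul, ← ENNReal.ofReal_natCast, ← ENNReal.ofReal_mul (by positivity)]
    apply ENNReal.ofReal_le_ofReal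
    calc (A.card : ℝ) * (C * (ε / (C * M))) ≤ M * (C * (ε / (C * M))) := by
          gcongr
      _ = ε := by field_simp
  · have hu : ∀ q ∈ A, ε / (C * M) ≤ |Real.sin (q * (N * t) / 2)| := by
      intro q hq
      by_contra hlt
      refine htE (Set.mem_biUnion hq ⟨ht, ?_⟩)
      push_cast
      rw [mul_assoc]
      exact not_le.1 hlt
    obtain ⟨h1, h2⟩ := hb _ hu
    rw [hMv, one_mul] at h1
    refine ⟨h1.trans hδη, fun m => (h2 m).trans ?_⟩
    rw [hMv, one_div_div]
    have : 1 / (M : ℝ) * (1 + C * M / ε) = 1 / M + C / ε := by field_simp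
    rw [this]
    linarith

/-! ### Approximation in measure by exponential sums -/

/-- The exponential `t ↦ e^{iat}`, written as in `IsMenshovSpectrum`. -/
noncomputable def expo (a t : ℝ) : ℂ := Complex.exp (Complex.I * (a : ℂ) * (t : ℂ))

theorem norm_expo (a t : ℝ) : ‖expo a t‖ = 1 := by
  have : Complex.I * (a : ℂ) * (t : ℂ) = Complex.I * ((a * t : ℝ) : ℂ) := by push_cast; ring
  rw [expo, this, mul_comm, Complex.norm_exp_ofReal_mul_I]

theorem expo_add (a b t : ℝ) : expo (a + b) t = expo a t * expo b t := by
  rw [expo, expo, expo, ← Complex.exp_add]; push_cast; ring_nf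

theorem norm_expo_sub_le (a b t : ℝ) : ‖expo a t - expo b t‖ ≤ |a - b| * |t| := by
  have h : expo a t - expo b t = expo b t * (expo (a - b) t - 1) := by
    rw [mul_sub, ← expo_add, mul_one]; ring_nf
  have h2 : expo (a - b) t = Complex.exp (Complex.I * (((a - b) * t : ℝ) : ℂ)) := by
    rw [expo]; push_cast; ring_nf
  rw [h, norm_mul, norm_expo, one_mul, h2, ← abs_mul]
  exact Real.norm_exp_I_mul_ofReal_sub_one_le

theorem continuous_expo (a : ℝ) : Continuous (expo a) := by
  unfold expo; fun_prop

/-- Stone–Weierstrass for the algebra of character polynomials, restricted to the compact interval.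
-/
theorem exists_expSum_near {φ : ℝ → ℂ} (hφ : Continuous φ) (T : ℝ) {η : ℝ} (hη : 0 < η) :
    ∃ (A : Finset ℝ) (c : ℝ → ℂ), ∀ t ∈ Set.Icc (-T) T, ‖∑ a ∈ A, c a * expo a t - φ t‖ ≤ η := by
  let L : ℝ →ₗ[ℝ] ℝ →ₗ[ℝ] ℝ := LinearMap.mul ℝ ℝ
  have hL : Continuous fun p : ℝ × ℝ => L p.1 p.2 := by
    simp only [L, LinearMap.mul_apply']; fun_prop
  let P := (BoundedContinuousFunction.charPoly Real.continuous_probChar hL).map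
    (BoundedContinuousFunction.toContinuousMapStarₐ ℂ)
  have hP : P.SeparatesPoints :=
    BoundedContinuousFunction.separatesPoints_charPoly Real.continuous_probChar
      Real.probChar_ne_one hL (fun v hv h => hv (by simpa [L] using congrArg (fun l => l 1) h))
  let R : C(ℝ, ℂ) →⋆ₐ[ℂ] C(Set.Icc (-T) T, ℂ) :=
    ContinuousMap.compStarAlgHom' ℂ ℂ ⟨Subtype.val, continuous_subtype_val⟩
  have hPR : (P.map R).SeparatesPoints := by
    intro x y hxy
    obtain ⟨f, ⟨g, hg, rfl⟩, hf⟩ := hP (fun h => hxy (Subtype.ext h))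
    exact ⟨_, ⟨R g, ⟨g, hg, rfl⟩, rfl⟩, hf⟩
  have htop := ContinuousMap.starSubalgebra_topologicalClosure_eq_top_of_separatesPoints _ hPR
  have hmem : R ⟨φ, hφ⟩ ∈ (P.map R).topologicalClosure := by rw [htop]; trivial
  obtain ⟨f, hf, hfd⟩ := Metric.mem_closure_iff.1 hmem η hη
  obtain ⟨g, ⟨g', hg', rfl⟩, rfl⟩ := hf
  obtain ⟨w, hw⟩ := (BoundedContinuousFunction.mem_charPoly g').1 hg'
  refine ⟨w.coeff.support, w.coeff, fun t ht => ?_⟩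
  have h1 := (ContinuousMap.dist_apply_le_dist (f := R ⟨φ, hφ⟩) (g := R _) ⟨t, ht⟩).trans hfd.le
  rw [dist_comm, dist_eq_norm] at h1
  change ‖g' t - φ t‖ ≤ η at h1
  rw [hw] at h1
  convert h1 using 3
  refine Finset.sum_congr rfl fun a _ => ?_
  congr 1
  simp [L, expo, Real.probChar_apply]
  ring_nf

/-- Simple functions approximate `g` in measure; bounded continuous functions approximate these in
`L¹`, and Markov's inequality concludes. -/
theorem exists_continuous_near_in_measure {g : ℝ → ℂ} (hg : AEMeasurable g volume) (T : ℝ) {ε η : ℝ}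
    (hε : 0 < ε) (hη : 0 < η) :
    ∃ φ : ℝ → ℂ, Continuous φ ∧
      volume {t : ℝ | t ∈ Set.Icc (-T) T ∧ η ≤ ‖φ t - g t‖} ≤ ENNReal.ofReal ε := by
  set μ : Measure ℝ := volume.restrict (Set.Icc (-T) T) with hμ
  have hgμ : AEStronglyMeasurable g μ := hg.restrict.aestronglyMeasurable
  have hmk : StronglyMeasurable (hgμ.mk g) := hgμ.stronglyMeasurable_mk
  have hmeas : TendstoInMeasure μ (fun n => (hmk.approx n : ℝ → ℂ)) atTop (hgμ.mk g) :=
    tendstoInMeasure_of_tendsto_ae (fun n => (hmk.approx n).aestronglyMeasurable)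
      (ae_of_all _ fun x => hmk.tendsto_approx x)
  have hη2 : 0 < ENNReal.ofReal (η / 2) := by simpa using hη
  have hε2 : 0 < ENNReal.ofReal (ε / 2) := by simpa using hε
  obtain ⟨n, hn⟩ := ((hmeas _ hη2).eventually (gt_mem_nhds hε2)).exists
  set f := hmk.approx n with hf
  obtain ⟨φ, hφ, -⟩ := (SimpleFunc.memLp_of_isFiniteMeasure f 1 μ).exists_boundedContinuous_eLpNorm_sub_le
    ENNReal.one_ne_top (ε := ENNReal.ofReal (η / 2) * ENNReal.ofReal (ε / 2)) (mul_ne_zero hη2.ne' hε2.ne')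
  refine ⟨φ, φ.continuous, ?_⟩
  have hM := mul_meas_ge_le_pow_eLpNorm (p := 1) μ one_ne_zero ENNReal.one_ne_top
    (f := (f : ℝ → ℂ) - ⇑φ)
    (f.aestronglyMeasurable.sub φ.continuous.aestronglyMeasurable) (ENNReal.ofReal (η / 2))
  simp only [ENNReal.toReal_one, ENNReal.rpow_one] at hM
  have hM2 := (ENNReal.mul_le_mul_iff_right hη2.ne' ENNReal.ofReal_ne_top).1 (hM.trans hφ)
  have hset : μ {t | η ≤ ‖φ t - g t‖} ≤ ENNReal.ofReal (ε / 2) + ENNReal.ofReal (ε / 2) := by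
    have hae : {t | η ≤ ‖φ t - g t‖} =ᵐ[μ] {t | η ≤ ‖φ t - hgμ.mk g t‖} := by
      filter_upwards [hgμ.ae_eq_mk] with t ht
      simp only [eq_iff_iff]
      change (η ≤ ‖φ t - g t‖) ↔ (η ≤ ‖φ t - hgμ.mk g t‖)
      rw [ht]
    rw [measure_congr hae]
    refine (measure_mono ?_).trans ((measure_union_le _ _).trans (add_le_add hn.le hM2))
    intro t ht
    by_contra hcon
    simp only [Set.mem_union, Set.mem_ofPred_eq, not_or, not_le, edist_eq_enorm_sub,
      Pi.sub_apply] at hcon ht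
    have h1 : ‖f t - hgμ.mk g t‖ < η / 2 := by
      have := hcon.1
      rwa [← ofReal_norm, ENNReal.ofReal_lt_ofReal_iff (by positivity)] at this
    have h2 : ‖f t - φ t‖ < η / 2 := by
      have := hcon.2
      rwa [← ofReal_norm, ENNReal.ofReal_lt_ofReal_iff (by positivity)] at this
    have h3 : φ t - hgμ.mk g t = -(f t - φ t) + (f t - hgμ.mk g t) := by ring
    rw [h3] at ht
    have := norm_add_le (-(f t - φ t)) (f t - hgμ.mk g t)
    rw [norm_neg] at this
    linarith
  rw [hμ, Measure.restrict_apply' measurableSet_Icc, ← ENNReal.ofReal_add (by positivity)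
    (by positivity), add_halves, Set.inter_comm] at hset
  exact hset

/-- In measure on bounded intervals, every measurable function is a limit of exponential sums. -/
theorem exists_expSum_near_in_measure {g : ℝ → ℂ} (hg : AEMeasurable g volume) (T : ℝ) {ε η : ℝ}
    (hε : 0 < ε) (hη : 0 < η) :
    ∃ (A : Finset ℝ) (c : ℝ → ℂ) (E : Set ℝ), volume E ≤ ENNReal.ofReal ε ∧
      ∀ t ∈ Set.Icc (-T) T, t ∉ E → ‖∑ a ∈ A, c a * expo a t - g t‖ ≤ η := by
  obtain ⟨φ, hφ, hE⟩ := exists_continuous_near_in_measure hg T hε (half_pos hη)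
  obtain ⟨A, c, hA⟩ := exists_expSum_near hφ T (half_pos hη)
  refine ⟨A, c, _, hE, fun t ht htE => ?_⟩
  have h1 : ‖φ t - g t‖ < η / 2 := by
    by_contra h; exact htE ⟨ht, not_lt.1 h⟩
  have h2 := norm_add_le (∑ a ∈ A, c a * expo a t - φ t) (φ t - g t)
  rw [sub_add_sub_cancel] at h2
  linarith [hA t ht]

/-! ### Exponential sums with separated frequencies -/

theorem expo_add_expo_neg (a t : ℝ) : expo a t + expo (-a) t = ((2 * Real.cos (a * t) : ℝ) : ℂ) := by
  have h1 : expo a t = Complex.exp (((a * t : ℝ) : ℂ) * Complex.I) := by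
    rw [expo]; push_cast; ring_nf
  have h2 : expo (-a) t = Complex.exp (-((a * t : ℝ) : ℂ) * Complex.I) := by
    rw [expo]; push_cast; ring_nf
  rw [h1, h2, Complex.ofReal_mul 2, Complex.ofReal_cos, Complex.ofReal_ofNat, Complex.two_cos]

theorem ofReal_cosSum_mul (b : ℕ → ℝ) (m N : ℕ) (t : ℝ) :
    ((cosSum b m (N * t) : ℝ) : ℂ) =
      ∑ k ∈ Finset.Icc 1 m, (b k : ℂ) * (expo (k * N) t + expo (-(k * N)) t) := by
  simp only [cosSum, Complex.ofReal_sum, expo_add_expo_neg]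
  refine Finset.sum_congr rfl fun k _ => ?_
  push_cast; ring_nf

/-- An exponential sum with one frequency `l + s l` for every integer `l ∈ [-L, L]`. -/
noncomputable def sepSum (L : ℕ) (s : ℤ → ℝ) (d : ℤ → ℂ) (t : ℝ) : ℂ :=
  ∑ l ∈ Finset.Icc (-(L : ℤ)) L, d l * expo (l + s l) t

/-- Frequencies in `A` may crowd near one integer. They are treated one at a time: `e^{iat}` is
replaced by its product with a kernel `p(Nt)` close to 1, whose frequencies `a ± kN` avoid the
integers already used once `N` is large. -/
theorem exists_sepSum_near_expSum {T : ℝ} (hT : 0 ≤ T) (A : Finset ℝ) (c : ℝ → ℂ) :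
    ∀ {ε η : ℝ}, 0 < ε → 0 < η → ∃ (L : ℕ) (s : ℤ → ℝ) (d : ℤ → ℂ) (E : Set ℝ),
      (∀ l, |s l| ≤ 1 / 2) ∧ volume E ≤ ENNReal.ofReal ε ∧
      ∀ t ∈ Set.Icc (-T) T, t ∉ E → ‖sepSum L s d t - ∑ a ∈ A, c a * expo a t‖ ≤ η := by
  induction A using Finset.induction_on with
  | empty =>
    intro ε η hε hη
    exact ⟨0, 0, 0, ∅, by simp, by simp, fun t _ _ => by simp [sepSum, hη.le]⟩
  | insert a A ha ih =>
    intro ε η hε hη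
    obtain ⟨L, s, d, E, hs, hE, hd⟩ := ih (half_pos hε) (half_pos hη)
    obtain ⟨B, -, hB⟩ := exists_kernel hT (half_pos hε)
    have hη' : 0 < η / (2 * (‖c a‖ + 1)) := by positivity
    obtain ⟨K, b, -, hb⟩ := hB _ hη'
    set r : ℤ := round a with hr
    set N : ℕ := L + r.natAbs + 1 with hN
    obtain ⟨E', hE', hb'⟩ := hb N (by omega)
    set L' : ℕ := K * N + r.natAbs + L with hL'
    -- All new frequencies have the same offset `a - r` from their indices, so one default value
    -- outside `[-L, L]` serves.
    set s' : ℤ → ℝ := fun l => if l ∈ Finset.Icc (-(L : ℤ)) L then s l else a - r with hs'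
    set d' : ℤ → ℂ := fun l => (if l ∈ Finset.Icc (-(L : ℤ)) L then d l else 0) +
      ∑ k ∈ Finset.Icc 1 K, ((if l = k * N + r then c a * b k else 0) +
        (if l = -(k * N) + r then c a * b k else 0)) with hd'
    have hbig : ∀ k ∈ Finset.Icc 1 K, (k : ℤ) * N + r ∉ Finset.Icc (-(L : ℤ)) L ∧
        -((k : ℤ) * N) + r ∉ Finset.Icc (-(L : ℤ)) L ∧
        (k : ℤ) * N + r ∈ Finset.Icc (-(L' : ℤ)) L' ∧
        -((k : ℤ) * N) + r ∈ Finset.Icc (-(L' : ℤ)) L' := by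
      intro k hk
      rw [Finset.mem_Icc] at hk
      have h1 : 1 * N ≤ k * N := Nat.mul_le_mul_right _ hk.1
      have h2 : k * N ≤ K * N := Nat.mul_le_mul_right _ hk.2
      have h3 : (k : ℤ) * N = ((k * N : ℕ) : ℤ) := by push_cast; ring
      rw [h3]
      simp only [Finset.mem_Icc]
      refine ⟨?_, ?_, ?_, ?_⟩ <;> omega
    have key : ∀ t, sepSum L' s' d' t = sepSum L s d t + c a * expo a t * cosSum b K (N * t) := by
      intro t
      have hterm : ∀ l, d' l * expo (l + s' l) t =
          (if l ∈ Finset.Icc (-(L : ℤ)) L then d l * expo (l + s l) t else 0) +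
          ∑ k ∈ Finset.Icc 1 K, ((if l = k * N + r then c a * b k * expo (k * N + a) t else 0) +
            (if l = -(k * N) + r then c a * b k * expo (-(k * N) + a) t else 0)) := by
        intro l
        simp only [hd']
        rw [add_mul, Finset.sum_mul]
        congr 1
        · by_cases h : l ∈ Finset.Icc (-(L : ℤ)) L
          · simp only [hs', if_pos h]
          · simp only [if_neg h, zero_mul]
        · refine Finset.sum_congr rfl fun k hk => ?_
          obtain ⟨h1, h2, -, -⟩ := hbig k hk
          rw [add_mul]
          congr 1
          · split_ifs with h
            · have : (l : ℝ) + s' l = k * N + a := by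
                simp only [hs', h, if_neg h1]; push_cast; ring
              rw [this]
            · simp
          · split_ifs with h
            · have : (l : ℝ) + s' l = -(k * N) + a := by
                simp only [hs', h, if_neg h2]; push_cast; ring
              rw [this]
            · simp
      rw [sepSum, Finset.sum_congr rfl fun l _ => hterm l, Finset.sum_add_distrib]
      congr 1
      · rw [← Finset.sum_filter]
        refine Finset.sum_congr ?_ fun _ _ => rfl
        ext l
        simp only [Finset.mem_filter, Finset.mem_Icc]
        omega
      · rw [Finset.sum_comm, ofReal_cosSum_mul, Finset.mul_sum]
        refine Finset.sum_congr rfl fun k hk => ?_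
        obtain ⟨-, -, h1, h2⟩ := hbig k hk
        rw [Finset.sum_add_distrib, Finset.sum_ite_eq', Finset.sum_ite_eq', if_pos h1, if_pos h2,
          expo_add, expo_add]
        ring
    refine ⟨L', s', d', E ∪ E', fun l => ?_, ?_, fun t ht htE => ?_⟩
    · simp only [hs']
      split_ifs
      · exact hs l
      · exact abs_sub_round a
    · refine (measure_union_le _ _).trans ((add_le_add hE hE').trans ?_)
      rw [← ENNReal.ofReal_add (by positivity) (by positivity), add_halves]
    · rw [Set.mem_union, not_or] at htE
      have h1 := hd t ht htE.1
      have h2 := (hb' t ht htE.2).1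
      rw [key, Finset.sum_insert ha]
      have h3 : sepSum L s d t + c a * expo a t * cosSum b K (N * t) -
          (c a * expo a t + ∑ x ∈ A, c x * expo x t) =
          (sepSum L s d t - ∑ x ∈ A, c x * expo x t) +
          c a * expo a t * ((cosSum b K (N * t) - 1 : ℝ) : ℂ) := by push_cast; ring
      have h4 : ‖c a * expo a t * ((cosSum b K (N * t) - 1 : ℝ) : ℂ)‖ ≤ η / 2 := by
        rw [norm_mul, norm_mul, norm_expo, mul_one, Complex.norm_real, Real.norm_eq_abs]
        calc _ ≤ (‖c a‖ + 1) * (η / (2 * (‖c a‖ + 1))) := by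
              gcongr
              linarith
          _ = η / 2 := by field_simp
      rw [h3]
      exact (norm_add_le _ _).trans (by linarith)

theorem exists_sepSum_near_in_measure {g : ℝ → ℂ} (hg : AEMeasurable g volume) {T ε η : ℝ}
    (hT : 0 ≤ T) (hε : 0 < ε) (hη : 0 < η) :
    ∃ (L : ℕ) (s : ℤ → ℝ) (d : ℤ → ℂ) (E : Set ℝ),
      (∀ l, |s l| ≤ 1 / 2) ∧ volume E ≤ ENNReal.ofReal ε ∧
      ∀ t ∈ Set.Icc (-T) T, t ∉ E → ‖sepSum L s d t - g t‖ ≤ η := by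
  obtain ⟨A, c, E₁, hE₁, h₁⟩ := exists_expSum_near_in_measure hg T (half_pos hε) (half_pos hη)
  obtain ⟨L, s, d, E₂, hs, hE₂, h₂⟩ := exists_sepSum_near_expSum hT A c (half_pos hε) (half_pos hη)
  refine ⟨L, s, d, E₁ ∪ E₂, hs, ?_, fun t ht htE => ?_⟩
  · refine (measure_union_le _ _).trans ((add_le_add hE₁ hE₂).trans ?_)
    rw [← ENNReal.ofReal_add (by positivity) (by positivity), add_halves]
  · rw [Set.mem_union, not_or] at htE
    have h := norm_add_le (sepSum L s d t - ∑ a ∈ A, c a * expo a t)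
      (∑ a ∈ A, c a * expo a t - g t)
    rw [sub_add_sub_cancel] at h
    linarith [h₁ t ht htE.1, h₂ t ht htE.2]

/-! ### Spectra containing arbitrary patterns -/

/-- The sequence `lam` contains, arbitrarily far away, simultaneous approximate translates by
`±N, ±2N, …, ±KN` of every finite set of the form `{l + s l : |l| ≤ L}` with `|s l| ≤ 1/2`. -/
def HasPatterns (lam : ℤ → ℝ) : Prop :=
  ∀ (L K : ℕ) (s : ℤ → ℝ), (∀ l, |s l| ≤ 1 / 2) → ∀ ρ : ℝ, 0 < ρ → ∀ N₀ : ℕ, ∃ N : ℕ, N₀ ≤ N ∧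
    ∀ k ∈ Finset.Icc 1 K, ∀ l ∈ Finset.Icc (-(L : ℤ)) L,
      |lam (k * N + l) - (k * N + (l + s l))| ≤ ρ ∧ |lam (-(k * N) + l) - (-(k * N) + (l + s l))| ≤ ρ

theorem finite_abs_lt_of_abs_sub_le {lam : ℤ → ℝ} (h : ∀ n : ℤ, |lam n - n| ≤ 1 / 2) (x : ℝ) :
    {k : ℤ | |lam k| < x}.Finite := by
  refine (Set.finite_Icc (-⌈x + 1⌉) ⌈x + 1⌉).subset fun n hn => ?_
  have h1 := h n
  have h2 : |lam n| < x := hn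
  rw [abs_le] at h1
  rw [abs_lt] at h2
  have h3 := Int.le_ceil (x + 1)
  constructor <;> (have : ∀ a b : ℤ, (a : ℝ) ≤ b → a ≤ b := fun a b h => by exact_mod_cast h)
  · apply this; push_cast; linarith [h1.1, h1.2, h2.1, h2.2]
  · apply this; linarith [h1.1, h1.2, h2.1, h2.2]

section PartialSums

variable {lam : ℤ → ℝ} (hfin : ∀ x : ℝ, {k : ℤ | |lam k| < x}.Finite)

/-- The partial sum over `|lam k| < x` of the series `∑ c k e^{i lam k t}`. -/
noncomputable def partialSum (c : ℤ → ℂ) (x t : ℝ) : ℂ :=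
  ∑ k ∈ (hfin x).toFinset, c k * expo (lam k) t

theorem continuous_partialSum (c : ℤ → ℂ) (x : ℝ) : Continuous (partialSum hfin c x) := by
  unfold partialSum
  exact continuous_finsetSum _ fun k _ => continuous_const.mul (continuous_expo _)

theorem partialSum_eq_of_le {c : ℤ → ℂ} {x y : ℝ} (hxy : y ≤ x) (hc : ∀ n, c n ≠ 0 → |lam n| < y)
    (t : ℝ) : partialSum hfin c x t = partialSum hfin c y t := by
  symm
  refine Finset.sum_subset (fun n hn => ?_) fun n _ hn => ?_
  · simp only [Set.Finite.mem_toFinset, Set.mem_ofPred_eq] at hn ⊢; exact hn.trans_le hxy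
  · simp only [Set.Finite.mem_toFinset, Set.mem_ofPred_eq] at hn
    by_cases h : c n = 0
    · simp [h]
    · exact absurd (hc n h) hn

/-- The coefficients of a block: weight `b k * d l` at the indices `±kN + l`. -/
noncomputable def blockCoeff (K L N : ℕ) (b : ℕ → ℝ) (d : ℤ → ℂ) (n : ℤ) : ℂ :=
  ∑ k ∈ Finset.Icc 1 K, ∑ l ∈ Finset.Icc (-(L : ℤ)) L,
    ((if n = k * N + l then b k * d l else 0) + (if n = -(k * N) + l then b k * d l else 0))

theorem partialSum_blockCoeff (K L N : ℕ) (b : ℕ → ℝ) (d : ℤ → ℂ) (x t : ℝ) :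
    partialSum hfin (blockCoeff K L N b d) x t =
      ∑ k ∈ Finset.Icc 1 K, (b k : ℂ) * ∑ l ∈ Finset.Icc (-(L : ℤ)) L, d l *
        ((if |lam (k * N + l)| < x then expo (lam (k * N + l)) t else 0) +
          (if |lam (-(k * N) + l)| < x then expo (lam (-(k * N) + l)) t else 0)) := by
  simp only [partialSum, blockCoeff, Finset.sum_mul]
  rw [Finset.sum_comm]
  refine Finset.sum_congr rfl fun k _ => ?_
  rw [Finset.sum_comm, Finset.mul_sum]
  refine Finset.sum_congr rfl fun l _ => ?_
  simp only [add_mul, ite_mul, zero_mul, Finset.sum_add_distrib]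
  rw [Finset.sum_ite_eq', Finset.sum_ite_eq']
  simp only [Set.Finite.mem_toFinset, Set.mem_ofPred_eq]
  split_ifs <;> ring

/-- Only the group `k = m` can be split by the cutoff, at cost `2βD` with `D = ∑ ‖d l‖`; moving
frequencies by `ρ` costs `2βD·Kρ|t|`. For `m = 0`, truncated subtraction gives the empty cosine sum,
as required. -/
theorem norm_partialSum_blockCoeff_sub_le {K L N : ℕ} {b : ℕ → ℝ} {d : ℤ → ℂ} {s : ℤ → ℝ}
    {β ρ x t : ℝ} (hb : ∀ k, |b k| ≤ β)
    (hpat : ∀ k ∈ Finset.Icc 1 K, ∀ l ∈ Finset.Icc (-(L : ℤ)) L,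
      |lam (k * N + l) - (k * N + (l + s l))| ≤ ρ ∧
      |lam (-(k * N) + l) - (-(k * N) + (l + s l))| ≤ ρ) (m : ℕ)
    (hlt : ∀ k ∈ Finset.Icc 1 K, k < m → ∀ l ∈ Finset.Icc (-(L : ℤ)) L,
      |lam (k * N + l)| < x ∧ |lam (-(k * N) + l)| < x)
    (hge : ∀ k ∈ Finset.Icc 1 K, m < k → ∀ l ∈ Finset.Icc (-(L : ℤ)) L,
      x ≤ |lam (k * N + l)| ∧ x ≤ |lam (-(k * N) + l)|) :
    ‖partialSum hfin (blockCoeff K L N b d) x t - cosSum b (min (m - 1) K) (N * t) * sepSum L s d t‖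
      ≤ 2 * β * (∑ l ∈ Finset.Icc (-(L : ℤ)) L, ‖d l‖) * (1 + K * (ρ * |t|)) := by
  set D := ∑ l ∈ Finset.Icc (-(L : ℤ)) L, ‖d l‖ with hD
  have hβ : 0 ≤ β := (abs_nonneg _).trans (hb 0)
  have hD0 : 0 ≤ D := Finset.sum_nonneg fun _ _ => norm_nonneg _
  set V : ℕ → ℂ := fun k => ∑ l ∈ Finset.Icc (-(L : ℤ)) L, d l *
        ((if |lam (k * N + l)| < x then expo (lam (k * N + l)) t else 0) +
          (if |lam (-(k * N) + l)| < x then expo (lam (-(k * N) + l)) t else 0)) with hV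
  set W : ℕ → ℂ := fun k =>
    if k < m then (expo (k * N) t + expo (-(k * N)) t) * sepSum L s d t else 0 with hW
  have hcos : (cosSum b (min (m - 1) K) (N * t) : ℂ) * sepSum L s d t =
      ∑ k ∈ Finset.Icc 1 K, (b k : ℂ) * W k := by
    rw [ofReal_cosSum_mul, Finset.sum_mul]
    simp only [hW, mul_ite, mul_zero]
    rw [← Finset.sum_filter]
    refine Finset.sum_congr ?_ fun k _ => by ring
    ext k
    simp only [Finset.mem_Icc, Finset.mem_filter, le_min_iff]
    omega
  have hVW : ∀ k ∈ Finset.Icc 1 K, ‖V k - W k‖ ≤ 2 * D * (ρ * |t|) + if k = m then 2 * D else 0 := by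
    intro k hk
    have hρ : ∀ l ∈ Finset.Icc (-(L : ℤ)) L, 0 ≤ ρ := fun l hl =>
      (abs_nonneg _).trans (hpat k hk l hl).1
    have hDρ : 0 ≤ 2 * D * (ρ * |t|) := by
      have := hρ 0 (by simp)
      positivity
    rcases lt_trichotomy k m with hkm | hkm | hkm
    · rw [if_neg hkm.ne, add_zero]
      simp only [hV, hW, if_pos hkm, sepSum]
      rw [Finset.mul_sum, ← Finset.sum_sub_distrib, hD, Finset.mul_sum, Finset.sum_mul]
      refine norm_sum_le_of_le _ fun l hl => ?_
      obtain ⟨h1, h2⟩ := hlt k hk hkm l hl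
      obtain ⟨h3, h4⟩ := hpat k hk l hl
      rw [if_pos h1, if_pos h2]
      have h5 : d l * (expo (lam (k * N + l)) t + expo (lam (-(k * N) + l)) t) -
          (expo (k * N) t + expo (-(k * N)) t) * (d l * expo (l + s l) t) =
          d l * ((expo (lam (k * N + l)) t - expo (k * N + (l + s l)) t) +
            (expo (lam (-(k * N) + l)) t - expo (-(k * N) + (l + s l)) t)) := by
        rw [expo_add (k * N) (l + s l), expo_add (-(k * N)) (l + s l)]; ring
      rw [h5, norm_mul]
      have h6 := (norm_expo_sub_le (lam (k * N + l)) (k * N + (l + s l)) t).trans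
        (mul_le_mul_of_nonneg_right h3 (abs_nonneg t))
      have h7 := (norm_expo_sub_le (lam (-(k * N) + l)) (-(k * N) + (l + s l)) t).trans
        (mul_le_mul_of_nonneg_right h4 (abs_nonneg t))
      have h8 := (norm_add_le _ _).trans (add_le_add h6 h7)
      calc _ ≤ ‖d l‖ * (ρ * |t| + ρ * |t|) := by gcongr
        _ = _ := by ring
    · rw [if_pos hkm]
      have hWk : W k = 0 := by simp [hW, hkm]
      rw [hWk, sub_zero]
      have : ‖V k‖ ≤ 2 * D := by
        simp only [hV]
        rw [hD, Finset.mul_sum]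
        refine norm_sum_le_of_le _ fun l _ => ?_
        rw [norm_mul, mul_comm]
        gcongr
        have hone : ∀ (p : Prop) [Decidable p] (z : ℂ), ‖z‖ = 1 → ‖if p then z else 0‖ ≤ 1 := by
          intro p _ z hz
          split_ifs <;> simp [hz]
        refine (norm_add_le _ _).trans ?_
        linarith [hone (|lam (k * N + l)| < x) _ (norm_expo (lam (k * N + l)) t),
          hone (|lam (-(k * N) + l)| < x) _ (norm_expo (lam (-(k * N) + l)) t)]
      linarith
    · have hWk : W k = 0 := by simp [hW, not_lt.2 hkm.le]
      have hVk : V k = 0 := by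
        refine Finset.sum_eq_zero fun l hl => ?_
        obtain ⟨h1, h2⟩ := hge k hk hkm l hl
        rw [if_neg (not_lt.2 h1), if_neg (not_lt.2 h2)]; simp
      rw [hWk, hVk, if_neg hkm.ne']
      simpa using hDρ
  rw [partialSum_blockCoeff, hcos, ← Finset.sum_sub_distrib]
  calc _ ≤ ∑ k ∈ Finset.Icc 1 K, β * (2 * D * (ρ * |t|) + if k = m then 2 * D else 0) := by
        refine norm_sum_le_of_le _ fun k hk => ?_
        rw [← mul_sub, norm_mul, Complex.norm_real, Real.norm_eq_abs]
        exact mul_le_mul (hb k) (hVW k hk) (norm_nonneg _) hβ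
    _ = β * (K * (2 * D * (ρ * |t|)) + if m ∈ Finset.Icc 1 K then 2 * D else 0) := by
        rw [← Finset.mul_sum, Finset.sum_add_distrib, Finset.sum_ite_eq']
        simp
    _ ≤ β * (K * (2 * D * (ρ * |t|)) + 2 * D) := by
        gcongr
        split_ifs
        · exact le_rfl
        · positivity
    _ = _ := by ring

theorem abs_index_bounds {L N k : ℕ} {l : ℤ} (hlam : ∀ n : ℤ, |lam n - n| ≤ 1 / 2)
    (hl : l ∈ Finset.Icc (-(L : ℤ)) L) :
    ((k : ℝ) * N - L - 1 / 2 ≤ |lam (k * N + l)| ∧ |lam (k * N + l)| ≤ k * N + L + 1 / 2) ∧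
    ((k : ℝ) * N - L - 1 / 2 ≤ |lam (-(k * N) + l)| ∧ |lam (-(k * N) + l)| ≤ k * N + L + 1 / 2) := by
  rw [Finset.mem_Icc] at hl
  have hl1 : -(L : ℝ) ≤ l := by exact_mod_cast hl.1
  have hl2 : (l : ℝ) ≤ L := by exact_mod_cast hl.2
  have h1 := abs_le.1 (hlam (k * N + l))
  have h2 := abs_le.1 (hlam (-(k * N) + l))
  push_cast at h1 h2
  have hkN : (0 : ℝ) ≤ k * N := by positivity
  refine ⟨⟨le_abs.2 (Or.inl ?_), abs_le.2 ⟨?_, ?_⟩⟩, le_abs.2 (Or.inr ?_), abs_le.2 ⟨?_, ?_⟩⟩ <;>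
    linarith [h1.1, h1.2, h2.1, h2.2]

/-- Every measurable function is approximated in measure on `[-T, T]` by a block of the series,
with arbitrarily high frequencies and with partial sums dominated by the function. -/
theorem exists_block (hlam : ∀ n : ℤ, |lam n - n| ≤ 1 / 2) (hpat : HasPatterns lam) {T ε : ℝ}
    (hT : 0 ≤ T) (hε : 0 < ε) :
    ∃ B : ℝ, 0 ≤ B ∧ ∀ g : ℝ → ℂ, AEMeasurable g volume → ∀ (X : ℕ) (η : ℝ), 0 < η →
      ∃ (X' : ℕ) (c : ℤ → ℂ) (E : Set ℝ), X < X' ∧ (∀ n, c n ≠ 0 → X ≤ |lam n| ∧ |lam n| < X') ∧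
        volume E ≤ ENNReal.ofReal ε ∧ ∀ t ∈ Set.Icc (-T) T, t ∉ E →
          ‖partialSum hfin c X' t - g t‖ ≤ η ∧ ∀ x, ‖partialSum hfin c x t‖ ≤ B * ‖g t‖ + η := by
  obtain ⟨B, hB0, hB⟩ := exists_kernel hT (half_pos hε)
  refine ⟨B, hB0, fun g hg X η hη => ?_⟩
  have hη₁ : 0 < η / (2 * (B + 1)) := by positivity
  obtain ⟨L, s, d, E₁, hs, hE₁, hG⟩ := exists_sepSum_near_in_measure hg hT (half_pos hε) hη₁
  set D := ∑ l ∈ Finset.Icc (-(L : ℤ)) L, ‖d l‖ with hD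
  have hD0 : 0 ≤ D := Finset.sum_nonneg fun _ _ => norm_nonneg _
  -- The order of choices matters: `β` is small against `D`, the kernel for `β` fixes `K`, then `ρ`
  -- is small against `K`, and `N` comes last.
  set β := η / (10 * (D + 1)) with hβ
  have hβ0 : 0 < β := by positivity
  have hβD : β * D ≤ η / 10 := by
    rw [hβ, div_mul_eq_mul_div, div_le_div_iff₀ (by positivity) (by norm_num)]
    nlinarith
  obtain ⟨K, b, hb, hK⟩ := hB β hβ0
  set ρ := 1 / (K * T + 1) with hρ
  have hρ0 : 0 < ρ := by positivity
  -- This lower bound gives `N - L - 1/2 ≥ X`, placing the block past `X`, and `N ≥ 2L + 1`, keeping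
  -- the groups of different `k` in successive ranges of `|lam|`.
  obtain ⟨N, hN, hN'⟩ := hpat L K s hs ρ hρ0 (X + 2 * L + 1)
  have hNr : (X : ℝ) + 2 * L + 1 ≤ N := by exact_mod_cast hN
  obtain ⟨E₂, hE₂, hK'⟩ := hK N (by omega)
  have herr : ∀ t ∈ Set.Icc (-T) T, 2 * β * D * (1 + K * (ρ * |t|)) ≤ 4 * (η / 10) := by
    intro t ht
    have h1 : K * (ρ * |t|) ≤ 1 := by
      have h2 : |t| ≤ T := abs_le.2 ht
      calc (K : ℝ) * (ρ * |t|) ≤ K * (ρ * T) := by gcongr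
        _ = K * T / (K * T + 1) := by rw [hρ]; ring
        _ ≤ 1 := by rw [div_le_one (by positivity)]; linarith
    have h3 : 0 ≤ β * D := by positivity
    nlinarith
  have hGD : ∀ t, ‖sepSum L s d t‖ ≤ D := fun t =>
    norm_sum_le_of_le _ fun l _ => by rw [norm_mul, norm_expo, mul_one]
  have hLN : (2 * L + 1 : ℝ) ≤ N := by
    have : (0 : ℝ) ≤ X := by positivity
    linarith
  refine ⟨K * N + L + 1 + X, blockCoeff K L N b d, E₁ ∪ E₂, by omega, fun n hn => ?_, ?_,
    fun t ht htE => ?_⟩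
  · obtain ⟨k, hk, hn⟩ := Finset.exists_ne_zero_of_sum_ne_zero hn
    obtain ⟨l, hl, hn⟩ := Finset.exists_ne_zero_of_sum_ne_zero hn
    obtain ⟨⟨h1, h2⟩, h3, h4⟩ := abs_index_bounds (N := N) (k := k) hlam hl
    rw [Finset.mem_Icc] at hk
    have hk1 : (1 : ℝ) * N ≤ k * N := by
      have : (1 : ℝ) ≤ k := by exact_mod_cast hk.1
      gcongr
    have hk2 : (k : ℝ) * N ≤ K * N := by
      have : (k : ℝ) ≤ K := by exact_mod_cast hk.2
      gcongr
    have hX : (0 : ℝ) ≤ X := by positivity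
    have hL : (0 : ℝ) ≤ L := by positivity
    have hnn : n = k * N + l ∨ n = -(k * N) + l := by
      by_contra hcon
      rw [not_or] at hcon
      simp [hcon.1, hcon.2] at hn
    push_cast
    rcases hnn with rfl | rfl <;> constructor <;> linarith
  · refine (measure_union_le _ _).trans ((add_le_add hE₁ hE₂).trans ?_)
    rw [← ENNReal.ofReal_add (by positivity) (by positivity), add_halves]
  · rw [Set.mem_union, not_or] at htE
    have hGt := hG t ht htE.1
    obtain ⟨hKt, hBt⟩ := hK' t ht htE.2
    constructor
    · have h1 := norm_partialSum_blockCoeff_sub_le hfin (x := ((K * N + L + 1 + X : ℕ) : ℝ)) (t := t)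
        (d := d) hb hN' (K + 1)
        (fun k hk _ l hl => by
          obtain ⟨⟨-, h2⟩, -, h4⟩ := abs_index_bounds (N := N) (k := k) hlam hl
          have hk2 : (k : ℝ) * N ≤ K * N := by
            have : (k : ℝ) ≤ K := by exact_mod_cast (Finset.mem_Icc.1 hk).2
            gcongr
          have hX : (0 : ℝ) ≤ X := by positivity
          push_cast
          constructor <;> linarith)
        (fun k hk hlt => by have := (Finset.mem_Icc.1 hk).2; omega)
      rw [show min (K + 1 - 1) K = K by simp] at h1
      have h2 : partialSum hfin (blockCoeff K L N b d) ((K * N + L + 1 + X : ℕ) : ℝ) t - g t =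
          (partialSum hfin (blockCoeff K L N b d) ((K * N + L + 1 + X : ℕ) : ℝ) t -
            cosSum b K (N * t) * sepSum L s d t) +
          ((cosSum b K (N * t) - 1 : ℝ) : ℂ) * sepSum L s d t + (sepSum L s d t - g t) := by
        push_cast; ring
      have h3 : ‖((cosSum b K (N * t) - 1 : ℝ) : ℂ) * sepSum L s d t‖ ≤ η / 10 := by
        rw [norm_mul, Complex.norm_real, Real.norm_eq_abs]
        exact (mul_le_mul hKt (hGD t) (norm_nonneg _) hβ0.le).trans hβD
      have h4 : η / (2 * (B + 1)) ≤ η / 2 := by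
        apply div_le_div_of_nonneg_left hη.le (by norm_num); linarith
      rw [h2]
      refine (norm_add₃_le).trans ?_
      linarith [herr t ht]
    · intro x
      -- The least such `m` is the only group that can straddle `x`: for `k < m`, `kN + L + 1/2 <
      -- x`, and for `k > m`, `kN - L - 1/2 ≥ x`.
      have hex : ∃ m : ℕ, x ≤ m * N + L + 1 / 2 := by
        obtain ⟨m, hm⟩ := exists_nat_ge x
        refine ⟨m, ?_⟩
        have hL : (0 : ℝ) ≤ L := by positivity
        have : (m : ℝ) * 1 ≤ m * N := by
          have : (1 : ℝ) ≤ N := by linarith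
          gcongr
        linarith
      classical
      have hm := Nat.find_spec hex
      set m := Nat.find hex with hmdef
      have h1 := norm_partialSum_blockCoeff_sub_le hfin (x := x) (t := t) (d := d) hb hN' m
        (fun k _ hkm l hl => by
          obtain ⟨⟨-, h2⟩, -, h4⟩ := abs_index_bounds (N := N) (k := k) hlam hl
          have := not_le.1 (Nat.find_min hex hkm)
          constructor <;> linarith)
        (fun k _ hmk l hl => by
          obtain ⟨⟨h2, -⟩, h4, -⟩ := abs_index_bounds (N := N) (k := k) hlam hl
          have : ((m : ℝ) + 1) * N ≤ k * N := by
            have : (m : ℝ) + 1 ≤ k := by exact_mod_cast hmk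
            gcongr
          constructor <;> linarith)
      have h2 : ‖(cosSum b (min (m - 1) K) (N * t) : ℂ) * sepSum L s d t‖ ≤
          B * (‖g t‖ + η / (2 * (B + 1))) := by
        rw [norm_mul, Complex.norm_real, Real.norm_eq_abs]
        refine mul_le_mul (hBt _) ?_ (norm_nonneg _) hB0
        have := norm_add_le (g t) (sepSum L s d t - g t)
        rw [add_sub_cancel] at this
        linarith
      have h3 : B * (η / (2 * (B + 1))) ≤ η / 2 := by
        rw [mul_div_assoc', div_le_div_iff₀ (by positivity) (by norm_num)]
        nlinarith
      have h5 := norm_add_le (partialSum hfin (blockCoeff K L N b d) x t -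
        cosSum b (min (m - 1) K) (N * t) * sepSum L s d t)
        (cosSum b (min (m - 1) K) (N * t) * sepSum L s d t)
      rw [sub_add_cancel] at h5
      linarith [herr t ht]

theorem partialSum_sum {ι : Type*} (I : Finset ι) (c : ι → ℤ → ℂ) (x t : ℝ) :
    partialSum hfin (fun n => ∑ j ∈ I, c j n) x t = ∑ j ∈ I, partialSum hfin (c j) x t := by
  simp only [partialSum, Finset.sum_mul]
  rw [Finset.sum_comm]

theorem exists_representation_of_hasPatterns (hlam : ∀ n : ℤ, |lam n - n| ≤ 1 / 2)
    (hpat : HasPatterns lam) {f : ℝ → ℂ} (hf : AEMeasurable f volume) :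
    ∃ c : ℤ → ℂ, ∀ᵐ t : ℝ ∂volume, Tendsto (fun x => partialSum hfin c x t) atTop (𝓝 (f t)) := by
  choose B hB0 hB using fun k : ℕ =>
    exists_block hfin hlam hpat (T := k) (ε := (1 / 2) ^ k) (by positivity) (by positivity)
  -- The tolerance of step `k` anticipates the constant of step `k + 1`, making `B (k + 1) * ‖g (k +
  -- 1) t‖ ≤ 1 / (k + 1)` at good points.
  set η : ℕ → ℝ := fun k => 1 / ((k + 1) * (B (k + 1) + 1)) with hη
  have hη0 : ∀ k, 0 < η k := fun k => by have := hB0 (k + 1); positivity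
  choose X' c' E' hX' hc' hE' hgood using fun (k : ℕ) (p : {g : ℝ → ℂ // AEMeasurable g volume} × ℕ) =>
    hB k p.1 p.1.2 p.2 (η k) (hη0 k)
  -- The state holds the residual still to be represented and a strict bound for the `|lam n|` used
  -- so far.
  let st : ℕ → {g : ℝ → ℂ // AEMeasurable g volume} × ℕ := fun k => Nat.rec (⟨f, hf⟩, 0)
    (fun k p => (⟨fun t => p.1.1 t - partialSum hfin (c' k p) (X' k p) t,
      p.1.2.sub (continuous_partialSum hfin _ _).aemeasurable⟩, X' k p)) k
  set g : ℕ → ℝ → ℂ := fun k => (st k).1.1 with hg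
  set X : ℕ → ℕ := fun k => (st k).2 with hX
  set c : ℕ → ℤ → ℂ := fun k => c' k (st k) with hc
  set E : ℕ → Set ℝ := fun k => E' k (st k) with hE
  have hX0 : X 0 = 0 := rfl
  have hg0 : g 0 = f := rfl
  have hgs : ∀ k t, g (k + 1) t = g k t - partialSum hfin (c k) (X (k + 1)) t := fun _ _ => rfl
  have hXlt : ∀ k, X k < X (k + 1) := fun k => hX' k (st k)
  have hXmono : StrictMono X := strictMono_nat_of_lt_succ hXlt
  have hcs : ∀ k n, c k n ≠ 0 → X k ≤ |lam n| ∧ |lam n| < X (k + 1) := fun k => hc' k (st k)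
  have hEv : ∀ k, volume (E k) ≤ ENNReal.ofReal ((1 / 2) ^ k) := fun k => hE' k (st k)
  have hEg : ∀ k : ℕ, ∀ t ∈ Set.Icc (-(k : ℝ)) k, t ∉ E k →
      ‖g (k + 1) t‖ ≤ η k ∧ ∀ x, ‖partialSum hfin (c k) x t‖ ≤ B k * ‖g k t‖ + η k := by
    intro k t ht htE
    obtain ⟨h1, h2⟩ := hgood k (st k) t ht htE
    exact ⟨by rw [hgs, ← norm_neg, neg_sub]; exact h1, h2⟩
  have hgsum : ∀ k t, ∑ j ∈ Finset.range k, partialSum hfin (c j) (X (j + 1)) t = f t - g k t := by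
    intro k t
    induction k with
    | zero => simp [hg0]
    | succ k ih => rw [Finset.sum_range_succ, ih, hgs]; ring
  -- Since `j ≤ X j ≤ |lam n|` whenever `c j n ≠ 0`, the finite sum over `j` loses no block. The
  -- cutoff sees the complete blocks before `k`, which telescope to `f - g k`, and part of block
  -- `k`.
  have hcut : ∀ {k : ℕ} {x : ℝ} (t : ℝ), X k ≤ x → x < X (k + 1) →
      partialSum hfin (fun n => ∑ j ∈ Finset.range (⌈|lam n|⌉₊ + 1), c j n) x t =
        f t - g k t + partialSum hfin (c k) x t := by
    intro k x t hkx hxk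
    have h1 : partialSum hfin (fun n => ∑ j ∈ Finset.range (⌈|lam n|⌉₊ + 1), c j n) x t =
        partialSum hfin (fun n => ∑ j ∈ Finset.range (k + 1), c j n) x t := by
      refine Finset.sum_congr rfl fun n hn => ?_
      simp only [Set.Finite.mem_toFinset, Set.mem_ofPred_eq] at hn
      congr 1
      have hbig : ∀ j, ⌈|lam n|⌉₊ + 1 ≤ j ∨ k + 1 ≤ j → c j n = 0 := by
        intro j hj
        by_contra hne
        have h2 := (hcs j n hne).1
        rcases hj with hj | hj
        · have h3 : j ≤ X j := hXmono.id_le j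
          have h4 := Nat.le_ceil |lam n|
          have h5 : ((⌈|lam n|⌉₊ + 1 : ℕ) : ℝ) ≤ X j := by exact_mod_cast hj.trans h3
          have h6 : (X j : ℝ) ≤ ⌈|lam n|⌉₊ := h2.trans h4
          push_cast at h5
          linarith
        · have h3 : (X (k + 1) : ℝ) ≤ X j := by exact_mod_cast hXmono.monotone hj
          linarith
      rcases le_total (⌈|lam n|⌉₊ + 1) (k + 1) with h | h
      · refine Finset.sum_subset (Finset.range_mono h) fun j _ hj => hbig j (Or.inl ?_)
        simpa using hj
      · refine (Finset.sum_subset (Finset.range_mono h) fun j _ hj => hbig j (Or.inr ?_)).symm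
        simpa using hj
    rw [h1, partialSum_sum, Finset.sum_range_succ, ← hgsum]
    congr 1
    refine Finset.sum_congr rfl fun j hj => ?_
    refine partialSum_eq_of_le hfin ?_ (fun n hn => (hcs j n hn).2) t
    have h3 : (X (j + 1) : ℝ) ≤ X k := by exact_mod_cast hXmono.monotone (Finset.mem_range.1 hj)
    linarith
  refine ⟨fun n => ∑ j ∈ Finset.range (⌈|lam n|⌉₊ + 1), c j n, ?_⟩
  have hsum : ∑' k, volume (E k) ≠ ⊤ := by
    refine ne_top_of_le_ne_top ?_ (ENNReal.tsum_le_tsum hEv)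
    rw [← ENNReal.ofReal_tsum_of_nonneg (fun _ => by positivity) summable_geometric_two]
    exact ENNReal.ofReal_ne_top
  filter_upwards [ae_eventually_notMem hsum] with t ht
  obtain ⟨k₀, hk₀⟩ := eventually_atTop.1 ht
  obtain ⟨k₁, hk₁⟩ := exists_nat_ge |t|
  have hsmall : ∀ k, max k₀ k₁ ≤ k → ‖g (k + 1) t‖ ≤ 1 / (k + 1) ∧
      ∀ x, ‖partialSum hfin (c (k + 1)) x t‖ ≤ 2 / (k + 1) := by
    intro k hk
    have hmem : ∀ j, k ≤ j → t ∈ Set.Icc (-(j : ℝ)) j := fun j hj => by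
      rw [Set.mem_Icc, ← abs_le]
      refine hk₁.trans ?_
      exact_mod_cast ((le_max_right _ _).trans hk).trans hj
    have hk0 : k₀ ≤ k := (le_max_left _ _).trans hk
    obtain ⟨h1, -⟩ := hEg k t (hmem k le_rfl) (hk₀ k hk0)
    obtain ⟨-, h2⟩ := hEg (k + 1) t (hmem _ (Nat.le_succ k)) (hk₀ _ (hk0.trans (Nat.le_succ k)))
    have hk' : (0 : ℝ) < k + 1 := by positivity
    have hηle : ∀ j, η j ≤ 1 / (j + 1) := by
      intro j
      apply one_div_le_one_div_of_le (by positivity)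
      have := hB0 (j + 1)
      nlinarith [(by positivity : (0 : ℝ) < j + 1)]
    refine ⟨h1.trans (hηle k), fun x => (h2 x).trans ?_⟩
    have h3 : B (k + 1) * ‖g (k + 1) t‖ ≤ 1 / (k + 1) := by
      refine (mul_le_mul_of_nonneg_left h1 (hB0 _)).trans ?_
      have := hB0 (k + 1)
      rw [hη]
      simp only
      rw [mul_one_div, div_le_div_iff₀ (by positivity) (by positivity)]
      nlinarith
    have h4 : η (k + 1) ≤ 1 / (k + 1) := by
      refine (hηle (k + 1)).trans (one_div_le_one_div_of_le (by positivity) ?_)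
      push_cast; linarith
    calc _ ≤ 1 / ((k : ℝ) + 1) + 1 / (k + 1) := add_le_add h3 h4
      _ = _ := by ring
  rw [Metric.tendsto_atTop]
  intro δ hδ
  obtain ⟨k₂, hk₂⟩ := exists_nat_gt (3 / δ)
  set k₃ := max (max k₀ k₁) k₂ with hk₃
  refine ⟨X (k₃ + 1), fun x hx => ?_⟩
  have hex : ∃ k, x < X (k + 1) := by
    obtain ⟨k, hk⟩ := exists_nat_gt x
    refine ⟨k, hk.trans_le ?_⟩
    exact_mod_cast (Nat.le_succ k).trans (hXmono.id_le (k + 1))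
  classical
  have hk := Nat.find_spec hex
  set k := Nat.find hex with hkdef
  have hlt : k₃ < k := by
    have h1 : (X (k₃ + 1) : ℝ) < X (k + 1) := lt_of_le_of_lt hx hk
    by_contra hcon
    have hle : k + 1 ≤ k₃ + 1 := by omega
    have h2 : (X (k + 1) : ℝ) ≤ X (k₃ + 1) := Nat.cast_le.2 (hXmono.monotone hle)
    linarith
  obtain ⟨j, hj⟩ : ∃ j, k = j + 1 := ⟨k - 1, by omega⟩
  have hkx : X k ≤ x := by
    have := Nat.find_min hex (m := j) (by omega)
    rw [hj]
    exact not_lt.1 this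
  obtain ⟨h1, h2⟩ := hsmall j (by omega)
  rw [← hj] at h1 h2
  rw [hcut t hkx hk, dist_eq_norm]
  have h3 : f t - g k t + partialSum hfin (c k) x t - f t = partialSum hfin (c k) x t - g k t := by
    ring
  rw [h3]
  have h4 : (k₂ : ℝ) ≤ j := by exact_mod_cast (by omega : k₂ ≤ j)
  calc _ ≤ 2 / ((j : ℝ) + 1) + 1 / (j + 1) := (norm_sub_le _ _).trans (add_le_add (h2 x) h1)
    _ = 3 / ((j : ℝ) + 1) := by ring
    _ < δ := by
      rw [div_lt_iff₀ hδ] at hk₂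
      rw [div_lt_iff₀ (by positivity)]
      nlinarith

end PartialSums

/-! ### Patterns in random perturbations of the integers -/

section Random

variable {Ω : Type*} [MeasurableSpace Ω] {P : Measure Ω}

/-- Even if `a` is an endpoint, the interval of length `min ρ (1/2)` from `a` towards the centre
stays in the segment. -/
theorem le_measure_preimage_closedBall {Y : Ω → ℝ}
    (hY : pdf.IsUniform Y (Set.Icc (-(1 / 2) : ℝ) (1 / 2)) P volume) {a ρ : ℝ}
    (ha : |a| ≤ 1 / 2) :
    ENNReal.ofReal (min ρ (1 / 2)) ≤ P (Y ⁻¹' Metric.closedBall a ρ) := by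
  have hvol : volume (Set.Icc (-(1 / 2) : ℝ) (1 / 2)) = 1 := by
    rw [Real.volume_Icc]; norm_num
  rw [hY.measure_preimage (by rw [hvol]; exact one_ne_zero) (by rw [hvol]; exact ENNReal.one_ne_top)
    Metric.isClosed_closedBall.measurableSet, hvol, div_one]
  rw [abs_le] at ha
  have h1 := min_le_left ρ (1 / 2)
  have h2 := min_le_right ρ (1 / 2)
  set m := min ρ (1 / 2)
  rcases le_total a 0 with h | h
  · calc ENNReal.ofReal m = volume (Set.Icc a (a + m)) := by rw [Real.volume_Icc]; congr 1; ring
      _ ≤ _ := by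
        refine measure_mono fun x hx => ?_
        rw [Set.mem_Icc] at hx
        refine ⟨⟨by linarith, by linarith⟩, ?_⟩
        rw [Metric.mem_closedBall, Real.dist_eq, abs_le]
        constructor <;> linarith
  · calc ENNReal.ofReal m = volume (Set.Icc (a - m) a) := by rw [Real.volume_Icc]; congr 1; ring
      _ ≤ _ := by
        refine measure_mono fun x hx => ?_
        rw [Set.mem_Icc] at hx
        refine ⟨⟨by linarith, by linarith⟩, ?_⟩
        rw [Metric.mem_closedBall, Real.dist_eq, abs_le]
        constructor <;> linarith

/-- Second Borel–Cantelli: the events indexed by `i` are independent, each of probability at least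
`min ρ (1/2)` to the power `card ι`. -/
theorem ae_frequently_forall_abs_sub_le {ι : Type*} [Fintype ι] {Y : ℕ × ι → Ω → ℝ}
    (hm : ∀ p, Measurable (Y p)) (hind : iIndepFun Y P)
    (hunif : ∀ p, pdf.IsUniform (Y p) (Set.Icc (-(1 / 2) : ℝ) (1 / 2)) P volume) {a : ι → ℝ}
    (ha : ∀ j, |a j| ≤ 1 / 2) {ρ : ℝ} (hρ : 0 < ρ) :
    ∀ᵐ ω ∂P, ∃ᶠ i in atTop, ∀ j, |Y (i, j) ω - a j| ≤ ρ := by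
  classical
  have : IsProbabilityMeasure P := hind.isProbabilityMeasure
  set E : ℕ → Set Ω := fun i => ⋂ j ∈ (Finset.univ : Finset ι), Y (i, j) ⁻¹' Metric.closedBall (a j) ρ
    with hE
  have hball : ∀ j, MeasurableSet (Metric.closedBall (a j) ρ) := fun j =>
    Metric.isClosed_closedBall.measurableSet
  have hEm : ∀ i, MeasurableSet (E i) := fun i =>
    Finset.measurableSet_biInter _ fun j _ => hm _ (hball j)
  have hprod : ∀ s : Finset ℕ, P (⋂ i ∈ s, E i) =
      ∏ i ∈ s, ∏ j : ι, P (Y (i, j) ⁻¹' Metric.closedBall (a j) ρ) := by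
    intro s
    have h := hind.measure_inter_preimage_eq_mul (s ×ˢ (Finset.univ : Finset ι))
      (sets := fun p => Metric.closedBall (a p.2) ρ) fun p _ => hball p.2
    rw [Finset.prod_product] at h
    rw [← h]
    congr 1
    ext ω
    simp only [hE, Set.mem_iInter, Finset.mem_univ, true_imp_iff, Finset.mem_product, and_true]
    exact ⟨fun h p hp => h p.1 hp p.2, fun h i hi j => h (i, j) hi⟩
  have hone : ∀ i, P (E i) = ∏ j : ι, P (Y (i, j) ⁻¹' Metric.closedBall (a j) ρ) := fun i => by
    simpa using hprod {i}
  have hset : iIndepSet E P := (iIndepSet_iff_meas_biInter hEm).2 fun s => by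
    rw [hprod]; exact Finset.prod_congr rfl fun i _ => (hone i).symm
  have htop : ∑' i, P (E i) = ⊤ := by
    have hc : ENNReal.ofReal (min ρ (1 / 2)) ^ Fintype.card ι ≠ 0 := by
      refine pow_ne_zero _ (ENNReal.ofReal_pos.2 (by positivity)).ne'
    refine top_unique ((ENNReal.tsum_const_eq_top_of_ne_zero (α := ℕ) hc).symm.le.trans
      (ENNReal.tsum_le_tsum fun i => ?_))
    rw [hone, ← Finset.card_univ, ← Finset.prod_const]
    exact Finset.prod_le_prod' fun j _ => le_measure_preimage_closedBall (hunif _) (ha j)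
  have hlim := measure_limsup_eq_one hEm hset htop
  have hae : ∀ᵐ ω ∂P, ω ∈ limsup E atTop :=
    (mem_ae_iff_prob_eq_one (MeasurableSet.measurableSet_limsup hEm)).2 hlim
  filter_upwards [hae] with ω hω
  rw [mem_limsup_iff_frequently_mem] at hω
  refine hω.mono fun i hi j => ?_
  simp only [hE, Set.mem_iInter] at hi
  exact hi j (Finset.mem_univ j)

/-- The scales at which patterns of size `L`, `K` are looked for. -/
def scale (L K i : ℕ) : ℕ := (2 * L + 1) * (K + 2) ^ i

theorem scale_lower (L K i : ℕ) : 2 * L + 1 ≤ scale L K i :=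
  Nat.le_mul_of_pos_right _ (by positivity)

theorem scale_separated {L K i j : ℕ} (hij : i < j) :
    K * scale L K i + 2 * L + 1 ≤ scale L K j := by
  have h1 : scale L K (i + 1) ≤ scale L K j :=
    Nat.mul_le_mul_left _ (Nat.pow_le_pow_right (by omega) hij)
  have h2 : scale L K (i + 1) = K * scale L K i + 2 * scale L K i := by
    unfold scale; rw [pow_succ]; ring
  have := scale_lower L K i
  omega

theorem le_scale (L K i : ℕ) : i ≤ scale L K i :=
  (Nat.lt_pow_self (by omega : 1 < K + 2)).le.trans (Nat.le_mul_of_pos_left _ (by omega))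

/-- The index `±kN + l`, where `N` is the `i`-th scale. -/
def patternIndex (L K : ℕ)
    (p : ℕ × (Finset.Icc 1 K × Finset.Icc (-(L : ℤ)) L × Bool)) : ℤ :=
  if p.2.2.2 then ((p.2.1 : ℕ) : ℤ) * scale L K p.1 + p.2.2.1
  else -(((p.2.1 : ℕ) : ℤ) * scale L K p.1) + p.2.2.1

/-- Distinct positions must use distinct variables for independence to be inherited. Scales `N < N'`
are separated by `K N + L < N' - L`, and groups within one scale by `N ≥ 2L + 1`. -/
theorem patternIndex_injective (L K : ℕ) : Function.Injective (patternIndex L K) := by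
  rintro ⟨i, ⟨k, hk⟩, ⟨l, hl⟩, σ⟩ ⟨i', ⟨k', hk'⟩, ⟨l', hl'⟩, σ'⟩ h
  rw [Finset.mem_Icc] at hk hk' hl hl'
  have hN := scale_lower L K i
  have hN' := scale_lower L K i'
  have hcast : ∀ k N : ℕ, (k : ℤ) * N = ((k * N : ℕ) : ℤ) := fun k N => by push_cast; ring
  simp only [patternIndex, hcast] at h
  have h1 : 1 * scale L K i ≤ k * scale L K i := Nat.mul_le_mul_right _ hk.1
  have h1' : 1 * scale L K i' ≤ k' * scale L K i' := Nat.mul_le_mul_right _ hk'.1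
  have h2 : k * scale L K i ≤ K * scale L K i := Nat.mul_le_mul_right _ hk.2
  have h2' : k' * scale L K i' ≤ K * scale L K i' := Nat.mul_le_mul_right _ hk'.2
  have hi : i = i' := by
    rcases lt_trichotomy i i' with hlt | heq | hlt
    · have := scale_separated (L := L) (K := K) hlt
      cases σ <;> cases σ' <;> simp at h <;> omega
    · exact heq
    · have := scale_separated (L := L) (K := K) hlt
      cases σ <;> cases σ' <;> simp at h <;> omega
  subst hi
  have hkk : k = k' := by
    rcases lt_trichotomy k k' with hlt | heq | hlt
    · have h3 : (k + 1) * scale L K i ≤ k' * scale L K i := Nat.mul_le_mul_right _ hlt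
      rw [add_mul] at h3
      cases σ <;> cases σ' <;> simp at h <;> omega
    · exact heq
    · have h3 : (k' + 1) * scale L K i ≤ k * scale L K i := Nat.mul_le_mul_right _ hlt
      rw [add_mul] at h3
      cases σ <;> cases σ' <;> simp at h <;> omega
  subst hkk
  have hσ : σ = σ' := by
    cases σ <;> cases σ' <;> simp at h ⊢ <;> omega
  subst hσ
  have hll : l = l' := by
    cases σ <;> simp at h <;> omega
  subst hll
  rfl

theorem exists_rat_abs_le_near {x δ : ℝ} (hx : |x| ≤ 1 / 2) (hδ : 0 < δ) :
    ∃ q : ℚ, |(q : ℝ)| ≤ 1 / 2 ∧ |(q : ℝ) - x| ≤ δ := by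
  have hm : 0 < min δ (1 / 2) := by positivity
  have h1 := min_le_left δ (1 / 2)
  have h2 := min_le_right δ (1 / 2)
  rw [abs_le] at hx
  rcases le_total x 0 with h | h
  · obtain ⟨q, hq1, hq2⟩ := exists_rat_btwn (by linarith : x < x + min δ (1 / 2))
    refine ⟨q, ?_, ?_⟩ <;> rw [abs_le] <;> constructor <;> linarith
  · obtain ⟨q, hq1, hq2⟩ := exists_rat_btwn (by linarith : x - min δ (1 / 2) < x)
    refine ⟨q, ?_, ?_⟩ <;> rw [abs_le] <;> constructor <;> linarith

theorem ae_hasPatterns {r : ℤ → Ω → ℝ} (hr_meas : ∀ n, Measurable (r n)) (hr_indep : iIndepFun r P)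
    (hr_unif : ∀ n, pdf.IsUniform (r n) (Set.Icc (-(1 / 2) : ℝ) (1 / 2)) P volume) :
    ∀ᵐ ω ∂P, HasPatterns fun n : ℤ => (n : ℝ) + r n ω := by
  -- The patterns `s` are uncountably many, so null sets are collected only over rational patterns
  -- and tolerances `1/(m + 1)`.
  have hae : ∀ᵐ ω ∂P, ∀ (L K m : ℕ) (q : Finset.Icc (-(L : ℤ)) L → ℚ), (∀ l, |(q l : ℝ)| ≤ 1 / 2) →
      ∃ᶠ i in atTop, ∀ j, |r (patternIndex L K (i, j)) ω - q j.2.1| ≤ 1 / ((m : ℝ) + 1) := by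
    simp only [ae_all_iff]
    intro L K m q hq
    exact ae_frequently_forall_abs_sub_le (Y := fun p => r (patternIndex L K p))
      (a := fun j => (q j.2.1 : ℝ)) (fun p => hr_meas _)
      (hr_indep.precomp (patternIndex_injective L K)) (fun p => hr_unif _) (fun j => hq _)
      (by positivity)
  filter_upwards [hae] with ω hω
  intro L K s hs ρ hρ N₀
  choose q hq1 hq2 using fun l => exists_rat_abs_le_near (hs l) (half_pos hρ)
  obtain ⟨m, hm⟩ := exists_nat_one_div_lt (half_pos hρ)
  obtain ⟨i, hi, hj⟩ := (frequently_atTop.1 (hω L K m (fun l => q l) fun l => hq1 l)) N₀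
  refine ⟨scale L K i, hi.trans (le_scale L K i), fun k hk l hl => ?_⟩
  have h1 := hj (⟨k, hk⟩, ⟨l, hl⟩, true)
  have h2 := hj (⟨k, hk⟩, ⟨l, hl⟩, false)
  simp only [patternIndex, if_true, Bool.false_eq_true, if_false] at h1 h2
  have h3 := abs_le.1 (hq2 l)
  rw [abs_le] at h1 h2
  push_cast
  constructor <;> rw [abs_le] <;> constructor <;> linarith [h1.1, h1.2, h2.1, h2.2, h3.1, h3.2]

/-- Excluding the null event `Y = 1/2` rules out the collision of `n + 1/2` with `(n + 1) - 1/2`,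
hence gives strict monotonicity. -/
theorem ae_mem_Ico {Y : Ω → ℝ}
    (hY : pdf.IsUniform Y (Set.Icc (-(1 / 2) : ℝ) (1 / 2)) P volume) :
    ∀ᵐ ω ∂P, Y ω ∈ Set.Ico (-(1 / 2) : ℝ) (1 / 2) := by
  have hvol : volume (Set.Icc (-(1 / 2) : ℝ) (1 / 2)) = 1 := by
    rw [Real.volume_Icc]; norm_num
  change P (Y ⁻¹' (Set.Ico (-(1 / 2) : ℝ) (1 / 2))ᶜ) = 0
  rw [hY.measure_preimage (by rw [hvol]; exact one_ne_zero) (by rw [hvol]; exact ENNReal.one_ne_top)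
    measurableSet_Ico.compl, hvol, div_one]
  refine measure_mono_null (t := {1 / 2}) (fun x hx => ?_) (by simp)
  obtain ⟨⟨h1, h2⟩, h3⟩ := hx
  simp only [Set.mem_compl_iff, Set.mem_Ico, not_and, not_lt] at h3
  exact le_antisymm h2 (h3 h1)

end Random

theorem mainTheorem1 {Ω : Type*} [MeasurableSpace Ω] (P : Measure Ω) [IsProbabilityMeasure P]
    (r : ℤ → Ω → ℝ) (hr_meas : ∀ n, Measurable (r n))
    (hr_indep : iIndepFun r P)
    (hr_unif : ∀ n, pdf.IsUniform (r n) (Set.Icc (-(1 / 2) : ℝ) (1 / 2)) P volume) :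
    ∀ᵐ ω ∂P, IsMenshovSpectrum (fun n : ℤ => (n : ℝ) + r n ω) := by
  filter_upwards [ae_hasPatterns hr_meas hr_indep hr_unif,
    ae_all_iff.2 fun n => ae_mem_Ico (hr_unif n)] with ω hpat hmem
  have hlam : ∀ n : ℤ, |(n : ℝ) + r n ω - n| ≤ 1 / 2 := fun n => by
    rw [add_sub_cancel_left, abs_le]; exact ⟨(hmem n).1, (hmem n).2.le⟩
  refine ⟨strictMono_int_of_lt_succ fun n => ?_, finite_abs_lt_of_abs_sub_le hlam, fun f hf =>
    exists_representation_of_hasPatterns (finite_abs_lt_of_abs_sub_le hlam) hlam hpat hf⟩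
  have h1 := (hmem n).2
  have h2 := (hmem (n + 1)).1
  push_cast
  linarith
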